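/- Let $D\subset\mathbb R^m$ be compact with $\operatorname{int}D\neq\varnothing$, let $\partial D$ be its boundary, and let $ds$ denote integration over $\partial D$ against an arbitrary fixed Borel measure $\sigma$ on $\partial D$ (for example the surface measure); $dt$ is Lebesgue measure on $D$. Let $1\le p<\infty$, $\frac1p+\frac1q=1$ (so $q=\infty$ if $p=1$), let $|\cdot|$ be the Euclidean norm of $\mathbb R^n$, $L_p^n(D)=L_p(D;\mathbb R^n)$ with $\|u\|_p=(\int_D|u|^p\,dt)^{1/p}$, $C^n(D)=C(D;\mathbb R^n)$ with the maximum norm, and let $A:L_p^n(D)\to C^n(D)$ be a continuous linear operator with norm $\|A\|$. A function $g:T\times Z\to(-\infty,+\infty]$ is a normal integrand if for every $t$ the epigraph $\{(z,\alpha)\in Z\times\mathbb R: g(t,z)\le\alpha\}$ is closed and depends measurably on $t$; a set-valued map $t\mapsto S(t)$ is measurable if $\{t: S(t)\cap U\ne\varnothing\}$ is measurable (with respect to the completed measure) for every open $U$. Integrals of functions with values in $[-\infty,+\infty]$ are $\int g^+-\int g^-$, with value $+\infty$ if $\int g^+=+\infty$. Let $f:D\times\mathbb R^n\times\mathbb R^n\to(-\infty,+\infty]$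 and $\varphi:\partial D\times\mathbb R^n\to(-\infty,+\infty]$ be normal integrands, and let $F$ assign to each $(t,x)\in D\times\mathbb R^n$ a non-empty compact set $F(t,x)\subset\mathbb R^n$, with $t\mapsto F(t,x)$ measurable for every $x$. Put $\psi(t,x,y)=\inf\{|z-y|:z\in F(t,x)\}$ and, for $u\in L_p^n(D)$ and $r\in\mathbb R$, $$J(u)=\int_{\partial D}\varphi(s,(Au)(s))\,ds+\int_D f(t,(Au)(t),u(t))\,dt,\qquad J_r(u)=J(u)+r\Big(\int_D\psi^p(t,(Au)(t),u(t))\,dt\Big)^{1/p}.$$ Suppose that there are $M\in L_p(D)$ with $M>0$ a.e., and non-negative $k\in L_1(D)$, $k_1\in L_q(D)$, $k_2\in L_1(\partial D)$, such that $\|A\|\,\|M\|_p<1$ and, for almost every $t\in D$, respectively almost every $s\in\partial D$, $$\rho_H(F(t,x),F(t,x_1))\le M(t)|x-x_1|,\qquad |f(t,x_1,y_1)-f(t,x_2,y_2)|\le k(t)|x_1-x_2|+k_1(t)|y_1-y_2|,$$ $$|\varphi(s,x)-\varphi(s,y)|\le k_2(s)|x-y|$$ for all $x,y,x_1,x_2,y_1,y_2\in\mathbb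 R^n$, where $\rho_H$ is the Hausdorff distance (the last two inequalities being understood to include that the values of $f$ and $\varphi$ are finite). Set $$r_0=\frac{\|A\|}{1-\|A\|\,\|M\|_p}\Big(\int_{\partial D}k_2\,ds+\int_D k\,dt+\int_D k_1M\,dt\Big)+\|k_1\|_q .$$ Let $\bar u\in L_p^n(D)$ be a solution of the problem of minimizing $J(u)$ over all $u\in L_p^n(D)$ with $u(t)\in F(t,(Au)(t))$ for a.e. $t\in D$; that is, $\bar u$ satisfies this inclusion, $J(\bar u)$ is finite, and $J(\bar u)\le J(u)$ for every such $u$. Then for every real $r\ge r_0$ the value $J_r(\bar u)$ is finite and $J_r(\bar u)\le J_r(u)$ for all $u\in L_p^n(D)$. -/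

import Mathlib

open MeasureTheory TopologicalSpace
open scoped ENNReal

namespace OperatorInclusion

noncomputable section

/-- `ℝⁿ` with its Euclidean norm. -/
abbrev Euc (n : ℕ) : Type := EuclideanSpace ℝ (Fin n)

/-- Lebesgue measure on the compact set `D ⊆ ℝᵐ`. -/
abbrev leb {m : ℕ} (D : Compacts (Euc m)) : Measure D :=
  Measure.comap (Subtype.val : D → Euc m) volume

/-- The space `L_pⁿ(D)` of (classes of) `p`-integrable maps `D → ℝⁿ`, for Lebesgue measure on the
compact set `D ⊆ ℝᵐ`. -/
abbrev LpSpace {m : ℕ} (D : Compacts (Euc m)) (n : ℕ) (p : ℝ≥0∞) : Type :=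
  Lp (Euc n) p (leb D)

/-- The space `Cⁿ(D)` of continuous maps `D → ℝⁿ` with the norm `max_{t ∈ D} |x(t)|`. -/
abbrev CSpace {m : ℕ} (D : Compacts (Euc m)) (n : ℕ) : Type := C(D, Euc n)

/-- The topological boundary `∂D`. -/
abbrev Bdry {m : ℕ} (D : Compacts (Euc m)) : Type := ↥(frontier (D : Set (Euc m)))

/-- The inclusion `∂D → D`. -/
def bdryPoint {m : ℕ} {D : Compacts (Euc m)} (s : Bdry D) : D :=
  ⟨s.1, D.isCompact.isClosed.frontier_subset s.2⟩

/-- A set-valued map is measurable if every open set is hit on a measurable set of parameters;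
measurable sets are those of the completion of `μ` (Lebesgue measurable sets for Lebesgue
measure). -/
def MeasurableMultimap {T Y : Type*} [MeasurableSpace T] [TopologicalSpace Y]
    (μ : Measure T) (S : T → Set Y) : Prop :=
  ∀ U : Set Y, IsOpen U → NullMeasurableSet {t | (S t ∩ U).Nonempty} μ

/-- The epigraph, a subset of `Z × ℝ`, of a function with values in `(-∞, +∞]`. -/
def epigraph {Z : Type*} (g : Z → EReal) : Set (Z × ℝ) := {w | g w.1 ≤ (w.2 : EReal)}

/-- Normal integrands `f : T × Z → (-∞, +∞]`: all epigraphs `epi f_t` are closed and `t ↦ epi f_t`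
is measurable. -/
structure IsNormalIntegrand {T Z : Type*} [MeasurableSpace T] [TopologicalSpace Z]
    (μ : Measure T) (f : T → Z → EReal) : Prop where
  ne_bot : ∀ t z, f t z ≠ ⊥
  closed : ∀ t, IsClosed (epigraph (f t))
  measurable : MeasurableMultimap μ (fun t => epigraph (f t))

open Classical in
/-- The integral of an extended real function, `∫ g⁺ - ∫ g⁻`, equal to `+∞` as soon as
`∫ g⁺ = +∞`. -/
def extIntegral {T : Type*} [MeasurableSpace T] (μ : Measure T) (g : T → EReal) : EReal :=
  if ∫⁻ t, (g t).toENNReal ∂μ = ⊤ then ⊤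
  else ((∫⁻ t, (g t).toENNReal ∂μ : ℝ≥0∞) : EReal) - ((∫⁻ t, (-g t).toENNReal ∂μ : ℝ≥0∞) : EReal)

section Problem

variable {m n : ℕ} {D : Compacts (Euc m)} {p : ℝ≥0∞} [Fact (1 ≤ p)]

/-- `J(u) = ∫_{∂D} φ(s, (Au)(s)) dσ(s) + ∫_D f(t, (Au)(t), u(t)) dt`. -/
def costJ (σ : Measure (Bdry D)) (A : LpSpace D n p →L[ℝ] CSpace D n)
    (φ : Bdry D → Euc n → EReal) (f : D → Euc n × Euc n → EReal) (u : LpSpace D n p) : EReal :=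
  extIntegral σ (fun s => φ s (A u (bdryPoint s))) +
    extIntegral (leb D) (fun t => f t (A u t, u t))

/-- The solutions of the inclusion `u(t) ∈ F(t, (Au)(t))` for almost every `t ∈ D`,
`u ∈ L_pⁿ(D)`. -/
def inclusionSolutions (A : LpSpace D n p →L[ℝ] CSpace D n)
    (F : D → Euc n → NonemptyCompacts (Euc n)) : Set (LpSpace D n p) :=
  {u | ∀ᵐ t ∂leb D, u t ∈ F t (A u t)}

/-- `ψ(t, x, y) = inf {|z - y| : z ∈ F(t, x)}`. -/
def psi (F : D → Euc n → NonemptyCompacts (Euc n)) (t : D) (x y : Euc n) : ℝ :=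
  Metric.infDist y (F t x : Set (Euc n))

/-- `F₀(u) = (∫_D ψ(t, (Au)(t), u(t))^p dt)^(1/p)`, with values in `[0, +∞]`. -/
def penalty (A : LpSpace D n p →L[ℝ] CSpace D n)
    (F : D → Euc n → NonemptyCompacts (Euc n)) (u : LpSpace D n p) : ℝ≥0∞ :=
  eLpNorm (fun t => psi F t (A u t) (u t)) p (leb D)

/-- `J_r(u) = J(u) + r F₀(u)`. -/
def penalizedJ (σ : Measure (Bdry D)) (A : LpSpace D n p →L[ℝ] CSpace D n)
    (φ : Bdry D → Euc n → EReal) (f : D → Euc n × Euc n → EReal)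
    (F : D → Euc n → NonemptyCompacts (Euc n)) (r : ℝ) (u : LpSpace D n p) : EReal :=
  costJ σ A φ f u + (r : EReal) * (penalty A F u : EReal)

/-- `r₀ = ‖A‖ / (1 - ‖A‖ ‖M‖_p) * (∫_{∂D} k₂ + ∫_D k + ∫_D k₁ M) + ‖k₁‖_q`. -/
def threshold (σ : Measure (Bdry D)) (A : LpSpace D n p →L[ℝ] CSpace D n) (q : ℝ≥0∞)
    (M k k₁ : D → ℝ) (k₂ : Bdry D → ℝ) : ℝ :=
  ‖A‖ / (1 - ‖A‖ * (eLpNorm M p (leb D)).toReal) *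
      ((∫ s, k₂ s ∂σ) + (∫ t, k t ∂leb D) + ∫ t, k₁ t * M t ∂leb D) +
    (eLpNorm k₁ q (leb D)).toReal

end Problem

/-- `ū` is a solution of the problem of minimizing `J` over `S`: it lies in `S`, `J(ū)` is finite,
and `J(ū) ≤ J(u)` for all `u ∈ S`. -/
def IsMinimizer {X : Type*} (J : X → EReal) (S : Set X) (ū : X) : Prop :=
  ū ∈ S ∧ J ū ≠ ⊥ ∧ J ū ≠ ⊤ ∧ ∀ u ∈ S, J ū ≤ J u

end

end OperatorInclusion

open OperatorInclusion

/-! This is exact penalization. Write `N = ‖M‖_p` and let `E` be the penalty of an arbitrary `u`. If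
some solution `w` of the inclusion is close enough to `u`, then `J ū ≤ J w`, and the Lipschitz
bounds on `f` and `φ` estimate `J w - J u` by a multiple of `E`.

Such a `w` comes from a Filippov-type iteration (`exists_inclusionSolution_near`): each iterate is
moved almost to a nearest point of `F(t, (A U_i)(t))`. The new defect is at most `M(t)` times `‖A‖`
times the last displacement, plus a small error, so `‖A‖ N < 1` makes the displacements summable.
For small `δ > 0` this gives `‖w - u‖ ≤ B = (E + 4δN)/(1 - ‖A‖N)` and, pointwise, `|w - u| ≤ ψ + (4δ
+ ‖A‖B) M`.

The pointwise bound produces the exact threshold: Hölder on `∫ k₁ ψ` gives `‖k₁‖_q E`, while every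
other term carries the factor `‖A‖ B`, up to `O(δ)`. Then `δ → 0`. -/

namespace OperatorInclusion

open Filter Topology

/-! ### Measurability of superpositions and approximate selections. -/

/-- Superposition of a Carathéodory function with a measurable map. -/
theorem aemeasurable_comp_of_ae_continuous {α ι : Type*} [MeasurableSpace α] {μ : Measure α}
    [TopologicalSpace ι] [MetrizableSpace ι] [MeasurableSpace ι] [SecondCountableTopology ι]
    [BorelSpace ι] {g : α → ι → ℝ} (hg : ∀ z, AEMeasurable (fun t => g t z) μ)
    (hc : ∀ᵐ t ∂μ, Continuous (g t)) {z : α → ι} (hz : AEMeasurable z μ) :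
    AEMeasurable (fun t => g t (z t)) μ := by
  classical
  -- Setting `g` to zero at the exceptional `t` makes it continuous in `z` for every `t`;
  -- measurability in `t` then holds for the completed σ-algebra.
  let g' : ι → NullMeasurableSpace α μ → ℝ := fun x t => if Continuous (g t) then g t x else 0
  have hg' : ∀ x, Measurable (g' x) := fun x => by
    have : AEMeasurable (fun t : α => if Continuous (g t) then g t x else 0) μ := (hg x).congr <| by
      filter_upwards [hc] with t ht
      exact (if_pos ht).symm
    exact this.nullMeasurable.measurable'
  have hcont : ∀ t, Continuous fun x => g' x t := fun t => by
    by_cases h : Continuous (g t)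
    · simpa only [g', if_pos h] using! h
    · simpa only [g', if_neg h] using! continuous_const
  have hm := measurable_uncurry_of_continuous_of_measurable hcont hg'
  have hcomp : @Measurable (NullMeasurableSpace α μ) ℝ _ _ (fun t => g' (z t) t) :=
    hm.comp (Measurable.prodMk hz.nullMeasurable.measurable' measurable_id)
  have : NullMeasurable (fun t => g' (z t) t : α → ℝ) μ := hcomp
  refine this.aemeasurable.congr ?_
  filter_upwards [hc] with t ht
  exact if_pos ht

/-- Superposition of a normal integrand with a measurable map. -/
theorem IsNormalIntegrand.aemeasurable_comp {α Z : Type*} [MeasurableSpace α] {μ : Measure α}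
    [PseudoMetricSpace Z] [SecondCountableTopology Z] [MeasurableSpace Z] [BorelSpace Z]
    {f : α → Z → EReal} (hf : IsNormalIntegrand μ f) {z : α → Z} (hz : AEMeasurable z μ) :
    AEMeasurable (fun t => f t (z t)) μ := by
  rcases isEmpty_or_nonempty Z with hZ | hZ
  · have : IsEmpty α := ⟨fun t => hZ.elim (z t)⟩
    exact (measurable_of_empty _).aemeasurable
  have key : ∀ a : ℝ, NullMeasurableSet {t | f t (z t) ≤ (a : EReal)} μ := by
    intro a
    -- As the epigraph is closed, it suffices to approximate `(z t, a)` by epigraph points at each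
    -- scale `1/(j+1)`; balls around a dense sequence make this a countable condition.
    have heq : {t | f t (z t) ≤ (a : EReal)} = ⋂ j : ℕ, ⋃ i : ℕ,
        (z ⁻¹' Metric.ball (denseSeq Z i) (1 / ((j : ℝ) + 1))) ∩
        {t | (epigraph (f t) ∩ (Metric.ball (denseSeq Z i) (1 / ((j : ℝ) + 1)) ×ˢ
          Set.Iio (a + 1 / ((j : ℝ) + 1)))).Nonempty} := by
      ext t
      simp only [Set.mem_iInter, Set.mem_iUnion, Set.mem_inter_iff, Set.mem_preimage,
        Set.mem_ofPred_eq]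
      constructor
      · intro h j
        have hj : (0 : ℝ) < 1 / ((j : ℝ) + 1) := Nat.one_div_pos_of_nat
        obtain ⟨i, hi⟩ := Metric.denseRange_iff.1 (denseRange_denseSeq Z) (z t) _ hj
        exact ⟨i, hi, (z t, a), h, hi, by simpa using hj⟩
      · intro h
        have hmem : (z t, a) ∈ closure (epigraph (f t)) := by
          rw [Metric.mem_closure_iff]
          intro ε hε
          obtain ⟨j, hj⟩ := exists_nat_one_div_lt (half_pos hε)
          obtain ⟨i, hi, w, hw, hwi, hwa⟩ := h j
          -- Only an upper bound on `w.2` is known; epigraphs are upward closed, so the height can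
          -- be raised to `a`.
          refine ⟨(w.1, max w.2 a), ?_, ?_⟩
          · exact le_trans hw (EReal.coe_le_coe_iff.2 (le_max_left _ _))
          · have h1 : dist (z t) w.1 < ε := by
              have := dist_triangle_right (z t) w.1 (denseSeq Z i)
              rw [Metric.mem_ball] at hi hwi
              linarith
            have h2 : dist a (max w.2 a) < ε := by
              rw [Set.mem_Iio] at hwa
              rw [Real.dist_eq, abs_lt]
              constructor
              · rcases max_cases w.2 a with ⟨h, _⟩ | ⟨h, _⟩ <;> rw [h] <;> linarith
              · linarith [le_max_right w.2 a]
            exact max_lt h1 h2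
        rwa [(hf.closed t).closure_eq] at hmem
    rw [heq]
    refine NullMeasurableSet.iInter fun j => NullMeasurableSet.iUnion fun i => ?_
    exact (hz.nullMeasurable Metric.isOpen_ball.measurableSet).inter
      (hf.measurable _ (Metric.isOpen_ball.prod isOpen_Iio))
  have : @Measurable (NullMeasurableSpace α μ) EReal _ _ (fun t => f t (z t)) := by
    refine measurable_of_Iic fun a => ?_
    induction a with
    | bot =>
      convert! MeasurableSet.empty using 1
      ext t
      simpa using hf.ne_bot t (z t)
    | top =>
      convert! MeasurableSet.univ using 1
      ext t
      simp
    | coe a => exact key a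
  exact NullMeasurable.aemeasurable this

theorem infDist_le_infDist_add {E : Type*} [MetricSpace E] (K L : NonemptyCompacts E) (y z : E) :
    Metric.infDist y (K : Set E) ≤ Metric.infDist z (L : Set E) + dist y z + dist K L := by
  have h1 : Metric.infDist y (K : Set E) ≤ Metric.infDist y (L : Set E) + dist K L := by
    rw [dist_comm K L]
    exact Metric.infDist_le_infDist_add_hausdorffDist (edist_ne_top L K)
  have h2 := Metric.infDist_le_infDist_add_dist (x := y) (y := z) (s := (L : Set E))
  linarith

/-- The distance is a Carathéodory function of `(y, x)`: it is below `a` exactly when `F` hits the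
open ball of radius `a`, and the Lipschitz bound on `F` gives joint continuity. -/
theorem aemeasurable_infDist_comp {α X E : Type*} [MeasurableSpace α] {μ : Measure α}
    [NormedAddCommGroup X] [SecondCountableTopology X] [MeasurableSpace X] [BorelSpace X]
    [NormedAddCommGroup E] [SecondCountableTopology E] [MeasurableSpace E] [BorelSpace E]
    {F : α → X → NonemptyCompacts E}
    (hF : ∀ x, MeasurableMultimap μ (fun t => (F t x : Set E)))
    {M : α → ℝ} (hL : ∀ᵐ t ∂μ, ∀ x x₁, dist (F t x) (F t x₁) ≤ M t * ‖x - x₁‖)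
    {x : α → X} (hx : AEMeasurable x μ) {y : α → E} (hy : AEMeasurable y μ) :
    AEMeasurable (fun t => Metric.infDist (y t) (F t (x t) : Set E)) μ := by
  have hmeas : ∀ z : E × X, AEMeasurable (fun t => Metric.infDist z.1 (F t z.2 : Set E)) μ := by
    intro z
    suffices h : @Measurable (NullMeasurableSpace α μ) ℝ _ _
        (fun t => Metric.infDist z.1 (F t z.2 : Set E)) from NullMeasurable.aemeasurable h
    refine measurable_of_Iio fun a => ?_
    have := hF z.2 _ (Metric.isOpen_ball (x := z.1) (ε := a))
    refine (congrArg (fun S : Set α => NullMeasurableSet S μ) ?_).mpr this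
    ext t
    simp only [Set.mem_preimage, Set.mem_Iio]
    rw [Metric.infDist_lt_iff (F t z.2).nonempty]
    simp only [Set.Nonempty, Set.mem_inter_iff, Metric.mem_ball, dist_comm]
    exact Iff.rfl
  have hcont : ∀ᵐ t ∂μ, Continuous fun z : E × X => Metric.infDist z.1 (F t z.2 : Set E) := by
    filter_upwards [hL] with t ht
    refine (LipschitzWith.of_le_add_mul (1 + (M t).toNNReal) fun z w => ?_).continuous
    refine (infDist_le_infDist_add (F t z.2) (F t w.2) z.1 w.1).trans ?_
    have h1 : dist z.1 w.1 ≤ dist z w := le_max_left _ _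
    have h2 : ‖z.2 - w.2‖ ≤ dist z w := by rw [← dist_eq_norm]; exact le_max_right _ _
    have h3 := ht z.2 w.2
    have h4 : M t * ‖z.2 - w.2‖ ≤ (M t).toNNReal * dist z w :=
      mul_le_mul (Real.le_coe_toNNReal _) h2 (norm_nonneg _) NNReal.zero_le_coe
    push_cast
    linarith
  have h := aemeasurable_comp_of_ae_continuous
    (g := fun t (z : E × X) => Metric.infDist z.1 (F t z.2 : Set E)) hmeas hcont (hy.prodMk hx)
  exact h

theorem exists_measurable_nat_selection {α : Type*} [MeasurableSpace α] {μ : Measure α}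
    {P : α → ℕ → Prop} (hP : ∀ᵐ t ∂μ, ∃ j, P t j)
    (hm : ∀ j, NullMeasurableSet {t | P t j} μ) :
    ∃ N : α → ℕ, Measurable N ∧ ∀ᵐ t ∂μ, P t (N t) := by
  classical
  choose S hSP hSm hSe using fun j => (hm j).exists_measurable_subset_ae_eq
  -- The second alternative makes the search terminate on the null set where no `S j` applies.
  let Q : α → ℕ → Prop := fun t j => t ∈ S j ∨ ∀ i, t ∉ S i
  have hQ : ∀ t, ∃ j, Q t j := fun t => by
    by_cases h : ∃ j, t ∈ S j
    · exact h.imp fun _ => Or.inl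
    · exact ⟨0, Or.inr (not_exists.1 h)⟩
  refine ⟨fun t => Nat.find (hQ t), measurable_find hQ fun j => ?_, ?_⟩
  · have : {t | Q t j} = S j ∪ ⋂ i, (S i)ᶜ := by
      ext t
      simp [Q]
    rw [this]
    exact (hSm j).union (MeasurableSet.iInter fun i => (hSm i).compl)
  · filter_upwards [hP, ae_all_iff.2 fun j => (hSe j).mem_iff] with t ht hS
    obtain ⟨j, hj⟩ := ht
    rcases Nat.find_spec (hQ t) with h | h
    · exact hSP _ h
    · exact absurd ((hS j).2 hj) (h j)

/-- A measurable map that is almost a nearest point map, with tolerance `δ`. -/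
theorem exists_aemeasurable_near_point {α E : Type*} [MeasurableSpace α] {μ : Measure α}
    [NormedAddCommGroup E] [SecondCountableTopology E] [MeasurableSpace E] [BorelSpace E]
    {K : α → NonemptyCompacts E}
    (hK : ∀ y : α → E, AEMeasurable y μ →
      AEMeasurable (fun t => Metric.infDist (y t) (K t : Set E)) μ)
    {u : α → E} (hu : AEMeasurable u μ) {δ : α → ℝ} (hδ : AEMeasurable δ μ)
    (hδ0 : ∀ᵐ t ∂μ, 0 < δ t) :
    ∃ v : α → E, Measurable v ∧ ∀ᵐ t ∂μ,
      Metric.infDist (v t) (K t : Set E) ≤ δ t ∧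
      ‖v t - u t‖ ≤ Metric.infDist (u t) (K t : Set E) + δ t := by
  obtain ⟨N, hN, hP⟩ := exists_measurable_nat_selection (μ := μ)
    (P := fun t j => Metric.infDist (denseSeq E j) (K t : Set E) ≤ δ t ∧
      ‖denseSeq E j - u t‖ ≤ Metric.infDist (u t) (K t : Set E) + δ t) (by
        filter_upwards [hδ0] with t ht
        -- A dense point within `δ t` of a true nearest point meets both requirements, so choosing a
        -- first index replaces a measurable selection theorem.
        obtain ⟨z, hz, hzd⟩ := (K t).isCompact.exists_infDist_eq_dist (K t).nonempty (u t)
        obtain ⟨j, hj⟩ := Metric.denseRange_iff.1 (denseRange_denseSeq E) z _ ht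
        refine ⟨j, ?_, ?_⟩
        · rw [dist_comm] at hj
          exact (Metric.infDist_le_dist_of_mem hz).trans hj.le
        · rw [hzd, ← dist_eq_norm]
          calc dist (denseSeq E j) (u t) ≤ dist (denseSeq E j) z + dist z (u t) :=
                dist_triangle _ _ _
            _ ≤ _ := by rw [dist_comm _ z, dist_comm z (u t)]; linarith) (fun j =>
      (nullMeasurableSet_le (hK _ aemeasurable_const) hδ).inter
        (nullMeasurableSet_le (aemeasurable_const.sub hu).norm ((hK _ hu).add hδ)))
  exact ⟨fun t => denseSeq E (N t), (measurable_from_nat).comp hN, hP⟩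

/-! ### Estimates for the iteration. -/

theorem toReal_eLpNorm_le_add_mul {α E : Type*} [MeasurableSpace α] {μ : Measure α} {p : ℝ≥0∞}
    [hp : Fact (1 ≤ p)] [NormedAddCommGroup E] {f : α → E} {g h : α → ℝ} {c : ℝ} (hc : 0 ≤ c)
    (hg : MemLp g p μ) (hh : MemLp h p μ) (hfgh : ∀ᵐ t ∂μ, ‖f t‖ ≤ g t + c * h t) :
    (eLpNorm f p μ).toReal ≤ (eLpNorm g p μ).toReal + c * (eLpNorm h p μ).toReal := by
  have hch : MemLp (c • h) p μ := hh.const_smul c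
  have h1 : eLpNorm f p μ ≤ eLpNorm g p μ + eLpNorm (c • h) p μ :=
    (eLpNorm_mono_ae_real hfgh).trans (eLpNorm_add_le hg.1 hch.1 hp.out)
  have h2 := ENNReal.toReal_mono (ENNReal.add_ne_top.2 ⟨hg.2.ne, hch.2.ne⟩) h1
  rw [ENNReal.toReal_add hg.2.ne hch.2.ne, eLpNorm_const_smul, ENNReal.toReal_mul] at h2
  simpa [abs_of_nonneg hc] using! h2

/-- Used twice: for the norms of the increments, with `m = ‖M‖_p`, and for their pointwise sizes,
with `m = M t`. The tolerances occur in two sums, once as the current selection error and once as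
the defect left by the previous step. -/
theorem sum_range_le_of_recursive_le {x d ε : ℕ → ℝ} {e m α : ℝ} (h0 : x 0 ≤ e + ε 0 * m)
    (h : ∀ i, x (i + 1) ≤ (ε i + α * d i) * m + ε (i + 1) * m) (N : ℕ) :
    ∑ i ∈ Finset.range (N + 1), x i ≤
      e + ((∑ i ∈ Finset.range (N + 1), ε i) + (∑ i ∈ Finset.range N, ε i) +
        α * ∑ i ∈ Finset.range N, d i) * m := by
  induction N with
  | zero => simpa using h0
  | succ N ih =>
    rw [Finset.sum_range_succ x, Finset.sum_range_succ ε (N + 1), Finset.sum_range_succ d N]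
    have := h N
    rw [Finset.sum_range_succ ε N] at ih ⊢
    linarith

theorem sum_range_half_pow_le {δ : ℝ} (hδ : 0 ≤ δ) (N : ℕ) :
    ∑ i ∈ Finset.range N, δ * (1 / 2) ^ i ≤ 2 * δ := by
  rw [← Finset.mul_sum]
  have := sum_geometric_two_le N
  nlinarith

/-! ### Solutions of the inclusion near a given `u`. -/

section Inclusion

variable {m n : ℕ} {D : Compacts (Euc m)} {p : ℝ≥0∞} [Fact (1 ≤ p)]
  {A : LpSpace D n p →L[ℝ] CSpace D n} {F : D → Euc n → NonemptyCompacts (Euc n)} {M : D → ℝ}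

theorem norm_apply_sub_le (A : LpSpace D n p →L[ℝ] CSpace D n) (u v : LpSpace D n p) (t : D) :
    ‖A u t - A v t‖ ≤ ‖A‖ * ‖u - v‖ := by
  have h := ContinuousMap.norm_coe_le_norm (A (u - v)) t
  rw [map_sub] at h
  refine h.trans ?_
  rw [← map_sub]
  exact A.le_opNorm _

theorem psi_nonneg (t : D) (x y : Euc n) : 0 ≤ psi F t x y := Metric.infDist_nonneg

theorem psi_le_add {t : D} (h : ∀ x x₁, dist (F t x) (F t x₁) ≤ M t * ‖x - x₁‖)
    (x y x' y' : Euc n) :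
    psi F t x y ≤ psi F t x' y' + ‖y - y'‖ + M t * ‖x - x'‖ := by
  have h1 := infDist_le_infDist_add (F t x) (F t x') y y'
  have h2 := h x x'
  rw [dist_eq_norm] at h1
  unfold psi
  linarith

theorem psi_eq_zero_of_mem {t : D} {x y : Euc n} (h : y ∈ F t x) : psi F t x y = 0 :=
  Metric.infDist_zero_of_mem h

theorem mem_of_psi_nonpos {t : D} {x y : Euc n} (h : psi F t x y ≤ 0) : y ∈ F t x :=
  ((F t x).isCompact.isClosed.mem_iff_infDist_zero (F t x).nonempty).2
    (le_antisymm h (psi_nonneg t x y))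

theorem aemeasurable_apply (u : LpSpace D n p) (A : LpSpace D n p →L[ℝ] CSpace D n) :
    AEMeasurable (fun t => A u t) (leb D) :=
  (A u).continuous.measurable.aemeasurable

/-- A single feasible `v` makes every penalty finite: `ψ` vanishes along `v`, and its Lipschitz
bound controls the change from `v` to `u`. -/
theorem memLp_psi (hFmeas : ∀ x, MeasurableMultimap (leb D) (fun t => (F t x : Set (Euc n))))
    (hM : MemLp M p (leb D))
    (hFLip : ∀ᵐ t ∂leb D, ∀ x x₁, dist (F t x) (F t x₁) ≤ M t * ‖x - x₁‖)
    {v : LpSpace D n p} (hv : v ∈ inclusionSolutions A F) (u : LpSpace D n p) :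
    MemLp (fun t => psi F t (A u t) (u t)) p (leb D) := by
  have hmeas : AEMeasurable (fun t => psi F t (A u t) (u t)) (leb D) :=
    aemeasurable_infDist_comp hFmeas hFLip (aemeasurable_apply u A)
      (Lp.aestronglyMeasurable u).aemeasurable
  have hb : MemLp (fun t => ‖(u - v : LpSpace D n p) t‖ + |M t| * (‖A‖ * ‖u - v‖)) p (leb D) :=
    (Lp.memLp (u - v)).norm.add (hM.abs.mul_const _)
  refine hb.mono' hmeas.aestronglyMeasurable ?_
  filter_upwards [hFLip, hv, Lp.coeFn_sub u v] with t ht hvt hsub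
  rw [Real.norm_of_nonneg (psi_nonneg _ _ _), hsub]
  have h1 := psi_le_add ht (A u t) (u t) (A v t) (v t)
  rw [psi_eq_zero_of_mem hvt, zero_add] at h1
  refine h1.trans (add_le_add le_rfl ?_)
  exact mul_le_mul (le_abs_self _) (norm_apply_sub_le A u v t) (norm_nonneg _) (abs_nonneg _)

/-- A tolerance proportional to `M` is positive a.e., lies in `L_p`, and merges with the Lipschitz
error into one multiple of `M`. -/
theorem exists_approximate_selection
    (hFmeas : ∀ x, MeasurableMultimap (leb D) (fun t => (F t x : Set (Euc n))))
    (hM : MemLp M p (leb D)) (hMpos : ∀ᵐ t ∂leb D, 0 < M t)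
    (hFLip : ∀ᵐ t ∂leb D, ∀ x x₁, dist (F t x) (F t x₁) ≤ M t * ‖x - x₁‖)
    (u : LpSpace D n p) (hψ : MemLp (fun t => psi F t (A u t) (u t)) p (leb D))
    {ε : ℝ} (hε : 0 < ε) :
    ∃ v : LpSpace D n p,
      (∀ᵐ t ∂leb D, ‖v t - u t‖ ≤ psi F t (A u t) (u t) + ε * M t) ∧
      ∀ᵐ t ∂leb D, psi F t (A u t) (v t) ≤ ε * M t := by
  obtain ⟨v, hv, hvP⟩ := exists_aemeasurable_near_point (μ := leb D)
    (K := fun t => F t (A u t)) (u := u) (δ := fun t => ε * M t)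
    (fun y hy => aemeasurable_infDist_comp hFmeas hFLip (aemeasurable_apply u A) hy)
    (Lp.aestronglyMeasurable u).aemeasurable (hM.1.aemeasurable.const_mul ε)
    (by filter_upwards [hMpos] with t ht using mul_pos hε ht)
  have hvL : MemLp v p (leb D) := by
    refine (((Lp.memLp u).norm.add hψ).add (hM.const_mul ε)).mono' hv.aestronglyMeasurable ?_
    filter_upwards [hvP] with t ht
    have h1 := norm_le_norm_add_norm_sub' (v t) (u t)
    have h2 := ht.2
    simp only [Pi.add_apply, psi]
    linarith
  refine ⟨hvL.toLp v, ?_, ?_⟩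
  · filter_upwards [hvP, hvL.coeFn_toLp] with t ht he
    rw [he]
    exact ht.2
  · filter_upwards [hvP, hvL.coeFn_toLp] with t ht he
    rw [he]
    exact ht.1

/-- Every `u` can be moved to a solution of the operator inclusion, with control of the
displacement both in norm and pointwise. -/
theorem exists_inclusionSolution_near
    (hFmeas : ∀ x, MeasurableMultimap (leb D) (fun t => (F t x : Set (Euc n))))
    (hM : MemLp M p (leb D)) (hMpos : ∀ᵐ t ∂leb D, 0 < M t)
    (hFLip : ∀ᵐ t ∂leb D, ∀ x x₁, dist (F t x) (F t x₁) ≤ M t * ‖x - x₁‖)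
    (hAM : ‖A‖ * (eLpNorm M p (leb D)).toReal < 1)
    (hψ : ∀ u : LpSpace D n p, MemLp (fun t => psi F t (A u t) (u t)) p (leb D))
    (u : LpSpace D n p) {δ B : ℝ} (hδ : 0 < δ)
    (hB : B = ((penalty A F u).toReal + 4 * δ * (eLpNorm M p (leb D)).toReal) /
      (1 - ‖A‖ * (eLpNorm M p (leb D)).toReal)) :
    ∃ w ∈ inclusionSolutions A F, ‖w - u‖ ≤ B ∧
      ∀ᵐ t ∂leb D, ‖w t - u t‖ ≤ psi F t (A u t) (u t) + (4 * δ + ‖A‖ * B) * M t := by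
  set μM := (eLpNorm M p (leb D)).toReal with hμM
  set E := (penalty A F u).toReal with hE
  have hμM0 : 0 ≤ μM := ENNReal.toReal_nonneg
  have hE0 : 0 ≤ E := ENNReal.toReal_nonneg
  have ha : 0 < 1 - ‖A‖ * μM := by linarith
  have hB0 : 0 ≤ B := by rw [hB]; positivity
  -- `B` solves `B = E + 4δN + ‖A‖N B`, which is what closes the induction in `hsum`.
  have hBeq : E + 4 * δ * μM = (1 - ‖A‖ * μM) * B := by
    rw [hB, mul_div_cancel₀ _ ha.ne']
  let ε : ℕ → ℝ := fun i => δ * (1 / 2) ^ i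
  have hε : ∀ i, 0 < ε i := fun i => by positivity
  have hT : ∀ N, ∑ i ∈ Finset.range N, ε i ≤ 2 * δ := sum_range_half_pow_le hδ.le
  choose S hS1 hS2 using fun (v : LpSpace D n p) (i : ℕ) =>
    exists_approximate_selection hFmeas hM hMpos hFLip v (hψ v) (hε i)
  let U : ℕ → LpSpace D n p := fun i => Nat.rec u (fun j v => S v j) i
  have hU1 : ∀ i, ∀ᵐ t ∂leb D, ‖U (i + 1) t - U i t‖ ≤ psi F t (A (U i) t) (U i t) + ε i * M t :=
    fun i => hS1 (U i) i
  let d : ℕ → ℝ := fun i => ‖U (i + 1) - U i‖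
  have hpsi : ∀ i, ∀ᵐ t ∂leb D,
      psi F t (A (U (i + 1)) t) (U (i + 1) t) ≤ (ε i + ‖A‖ * d i) * M t := by
    intro i
    filter_upwards [hS2 (U i) i, hFLip, hMpos] with t h1 h2 h3
    have h4 := psi_le_add h2 (A (U (i + 1)) t) (U (i + 1) t) (A (U i) t) (U (i + 1) t)
    have h5 := mul_le_mul_of_nonneg_left (norm_apply_sub_le A (U (i + 1)) (U i) t) h3.le
    rw [sub_self, norm_zero, add_zero] at h4
    have h6 : psi F t (A (U i) t) (U (i + 1) t) ≤ ε i * M t := h1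
    have h7 : M t * (‖A‖ * ‖U (i + 1) - U i‖) = ‖A‖ * d i * M t := by ring
    linarith
  have hnorm : ∀ i {g : D → ℝ} {c : ℝ}, 0 ≤ c → MemLp g p (leb D) →
      (∀ᵐ t ∂leb D, ‖U (i + 1) t - U i t‖ ≤ g t + c * M t) →
      d i ≤ (eLpNorm g p (leb D)).toReal + c * μM := by
    intro i g c hc hg h
    have := toReal_eLpNorm_le_add_mul (f := (U (i + 1) - U i : LpSpace D n p)) hc hg hM (by
      filter_upwards [h, Lp.coeFn_sub (U (i + 1)) (U i)] with t h1 h2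
      rw [h2]
      exact h1)
    rwa [← Lp.norm_def] at this
  have hd0 : d 0 ≤ E + ε 0 * μM := hnorm 0 (hε 0).le (hψ u) (hU1 0)
  have hstep : ∀ i, ∀ᵐ t ∂leb D, ‖U (i + 1 + 1) t - U (i + 1) t‖ ≤
      (ε i + ‖A‖ * d i) * M t + ε (i + 1) * M t := by
    intro i
    filter_upwards [hU1 (i + 1), hpsi i] with t h1 h2
    linarith
  have hd1 : ∀ i, d (i + 1) ≤ (ε i + ‖A‖ * d i) * μM + ε (i + 1) * μM := by
    intro i
    have h1 : 0 ≤ ε i + ‖A‖ * d i + ε (i + 1) := by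
      have := (hε i).le
      have := (hε (i + 1)).le
      have : 0 ≤ ‖A‖ * d i := by positivity
      linarith
    -- After the first step the displacement is bounded by a pure multiple of `M`; only step zero
    -- involves `ψ` at `u`.
    have h2 := hnorm (i + 1) (g := 0) h1 MemLp.zero (by
      filter_upwards [hstep i] with t h
      simp only [Pi.zero_apply]
      linarith)
    simp only [eLpNorm_zero, ENNReal.toReal_zero] at h2
    linarith
  have hsum : ∀ N, ∑ i ∈ Finset.range N, d i ≤ B := by
    intro N
    induction N with
    | zero => simpa using hB0
    | succ N ih =>
      have h1 := sum_range_le_of_recursive_le hd0 hd1 N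
      have h2 : ((∑ i ∈ Finset.range (N + 1), ε i) + (∑ i ∈ Finset.range N, ε i) +
          ‖A‖ * ∑ i ∈ Finset.range N, d i) * μM ≤ (2 * δ + 2 * δ + ‖A‖ * B) * μM := by
        gcongr
        · exact hT _
        · exact hT _
      linarith
  have hsumm : Summable d := summable_of_sum_range_le (fun i => norm_nonneg _) hsum
  have hcauchy : CauchySeq U := cauchySeq_of_summable_dist <| by
    refine hsumm.congr fun i => ?_
    rw [dist_comm, dist_eq_norm]
  obtain ⟨w, hw⟩ := cauchySeq_tendsto_of_complete hcauchy
  have hnormB : ∀ N, ‖U N - u‖ ≤ B := by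
    intro N
    have h1 := dist_le_range_sum_dist U N
    rw [dist_comm, dist_eq_norm] at h1
    refine h1.trans ((le_of_eq ?_).trans (hsum N))
    refine Finset.sum_congr rfl fun i _ => ?_
    rw [dist_comm, dist_eq_norm]
  have hpt : ∀ᵐ t ∂leb D, ∀ N,
      ‖U N t - u t‖ ≤ psi F t (A u t) (u t) + (4 * δ + ‖A‖ * B) * M t := by
    filter_upwards [hMpos, hU1 0, ae_all_iff.2 hstep] with t h1 h2 h3 N
    have hnn : 0 ≤ (4 * δ + ‖A‖ * B) * M t := by positivity
    cases N with
    | zero =>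
      have : ‖U 0 t - u t‖ = 0 := by simp [U]
      rw [this]
      exact add_nonneg (psi_nonneg _ _ _) hnn
    | succ N =>
      have h4 := sum_range_le_of_recursive_le (x := fun i => ‖U (i + 1) t - U i t‖) h2 h3 N
      have h5 : ‖U (N + 1) t - u t‖ ≤ ∑ i ∈ Finset.range (N + 1), ‖U (i + 1) t - U i t‖ := by
        have h := dist_le_range_sum_dist (fun i => U i t) (N + 1)
        rw [dist_comm, dist_eq_norm] at h
        refine h.trans (le_of_eq (Finset.sum_congr rfl fun i _ => ?_))
        rw [dist_comm, dist_eq_norm]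
      refine h5.trans (h4.trans ?_)
      refine add_le_add le_rfl (mul_le_mul_of_nonneg_right ?_ h1.le)
      have h6 := hT N
      have h7 := hT (N + 1)
      have h8 := mul_le_mul_of_nonneg_left (hsum N) (norm_nonneg A)
      linarith
  -- Convergence in `L_p` gives pointwise a.e. convergence only along a subsequence, whereas `A (U
  -- i)` converges uniformly to `A w`.
  obtain ⟨ns, hns, hlim⟩ := (tendstoInMeasure_of_tendsto_Lp hw).exists_seq_tendsto_ae
  refine ⟨w, ?_, ?_, ?_⟩
  · filter_upwards [hlim, ae_all_iff.2 hpsi, hFLip, hMpos] with t h1 h2 h3 h4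
    refine mem_of_psi_nonpos ?_
    have hψ0 : Tendsto (fun i => psi F t (A (U i) t) (U i t)) atTop (𝓝 0) := by
      rw [← tendsto_add_atTop_iff_nat 1]
      refine squeeze_zero (fun i => psi_nonneg _ _ _) h2 ?_
      have e1 : Tendsto ε atTop (𝓝 0) := by
        have h := (tendsto_pow_atTop_nhds_zero_of_lt_one (by norm_num : (0 : ℝ) ≤ 1 / 2)
          (by norm_num)).const_mul δ
        rwa [mul_zero] at h
      simpa using (e1.add (hsumm.tendsto_atTop_zero.const_mul ‖A‖)).mul_const (M t)
    have hA : Tendsto (fun i => ‖A w t - A (U i) t‖) atTop (𝓝 0) := by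
      refine squeeze_zero (fun i => norm_nonneg _) (fun i => norm_apply_sub_le A w (U i) t) ?_
      have := (tendsto_const_nhds (x := w)).sub hw
      simpa using this.norm.const_mul ‖A‖
    have hw' : Tendsto (fun k => ‖w t - U (ns k) t‖) atTop (𝓝 0) := by
      simpa using ((tendsto_const_nhds (x := w t)).sub h1).norm
    have hlim0 := ((hψ0.comp hns.tendsto_atTop).add hw').add
      ((hA.comp hns.tendsto_atTop).const_mul (M t))
    rw [mul_zero, add_zero, add_zero] at hlim0
    exact ge_of_tendsto' hlim0 fun k => psi_le_add h3 _ _ _ _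
  · exact le_of_tendsto' (hw.sub_const u).norm hnormB
  · filter_upwards [hlim, hpt] with t h1 h2
    exact le_of_tendsto' (h1.sub_const (u t)).norm fun k => h2 (ns k)

end Inclusion

/-! ### Reduction from extended to real values. -/

section ExtIntegral

variable {α : Type*} [MeasurableSpace α] {μ : Measure α} {g : α → EReal} {h : α → ℝ}

theorem lintegral_toENNReal_congr (hg : ∀ᵐ t ∂μ, g t = (h t : EReal)) :
    ∫⁻ t, (g t).toENNReal ∂μ = ∫⁻ t, ENNReal.ofReal (h t) ∂μ ∧
      ∫⁻ t, (-g t).toENNReal ∂μ = ∫⁻ t, ENNReal.ofReal (-h t) ∂μ := by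
  constructor <;> refine lintegral_congr_ae ?_ <;> filter_upwards [hg] with t ht <;> rw [ht]
  · exact EReal.real_coe_toENNReal _
  · rw [← EReal.coe_neg]
    exact EReal.real_coe_toENNReal _

theorem extIntegral_eq_integral (hg : ∀ᵐ t ∂μ, g t = (h t : EReal)) (hh : Integrable h μ) :
    extIntegral μ g = ((∫ t, h t ∂μ : ℝ) : EReal) := by
  obtain ⟨h1, h2⟩ := lintegral_toENNReal_congr hg
  have hp : ∫⁻ t, ENNReal.ofReal (h t) ∂μ ≠ ⊤ := hh.lintegral_lt_top.ne
  have hn : ∫⁻ t, ENNReal.ofReal (-h t) ∂μ ≠ ⊤ := hh.neg.lintegral_lt_top.ne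
  rw [extIntegral, h1, h2, if_neg hp, integral_eq_lintegral_pos_part_sub_lintegral_neg_part hh,
    EReal.coe_sub, EReal.coe_ennreal_toReal hp, EReal.coe_ennreal_toReal hn]

theorem integrable_of_extIntegral (hg : ∀ᵐ t ∂μ, g t = (h t : EReal)) (hh : AEMeasurable h μ)
    (ht : extIntegral μ g ≠ ⊤) (hb : extIntegral μ g ≠ ⊥) : Integrable h μ := by
  obtain ⟨h1, h2⟩ := lintegral_toENNReal_congr hg
  rw [extIntegral, h1, h2] at ht hb
  split_ifs at ht hb with hp
  · exact absurd rfl ht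
  have hn : ∫⁻ t, ENNReal.ofReal (-h t) ∂μ ≠ ⊤ := by
    intro hn
    rw [hn, EReal.coe_ennreal_top, EReal.sub_top] at hb
    exact hb rfl
  have h3 : ∀ t, ‖h t‖ₑ ≤ ENNReal.ofReal (h t) + ENNReal.ofReal (-h t) := by
    intro t
    rw [← ofReal_norm, Real.norm_eq_abs]
    rcases abs_cases (h t) with ⟨e, _⟩ | ⟨e, _⟩ <;> rw [e]
    · exact le_self_add
    · exact le_add_self
  refine ⟨hh.aestronglyMeasurable, (lintegral_mono h3).trans_lt ?_⟩
  rw [lintegral_add_left' hh.ennreal_ofReal]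
  exact ENNReal.add_lt_top.2 ⟨lt_top_iff_ne_top.2 hp, lt_top_iff_ne_top.2 hn⟩

end ExtIntegral

/-- In `EReal` both `⊤ - ⊤` and `⊥ - ⊥` equal `⊥`, of absolute value `⊤`; hence the Lipschitz bound
at coinciding points already forces finiteness. -/
theorem eq_coe_toReal_of_abs_sub_le {a : EReal} {c : ℝ} (h : (a - a).abs ≤ ENNReal.ofReal c) :
    a = (a.toReal : EReal) := by
  induction a with
  | coe x => rfl
  | bot =>
    have : ((⊥ : EReal) - ⊥) = ⊥ := rfl
    rw [this, EReal.abs_bot, top_le_iff] at h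
    exact absurd h ENNReal.ofReal_ne_top
  | top =>
    have : ((⊤ : EReal) - ⊤) = ⊥ := rfl
    rw [this, EReal.abs_bot, top_le_iff] at h
    exact absurd h ENNReal.ofReal_ne_top

theorem abs_toReal_sub_le {a b : EReal} {c : ℝ} (ha : a = (a.toReal : EReal))
    (hb : b = (b.toReal : EReal)) (hc : 0 ≤ c) (h : (a - b).abs ≤ ENNReal.ofReal c) :
    |a.toReal - b.toReal| ≤ c := by
  rw [ha, hb, ← EReal.coe_sub, EReal.abs_def] at h
  exact (ENNReal.ofReal_le_ofReal_iff hc).1 h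

theorem integral_mul_le_toReal_eLpNorm_mul {α : Type*} [MeasurableSpace α] {μ : Measure α}
    {p q : ℝ≥0∞} [ENNReal.HolderConjugate p q] {f g : α → ℝ} (hf : MemLp f p μ)
    (hg : MemLp g q μ) :
    ∫ t, f t * g t ∂μ ≤ (eLpNorm f p μ).toReal * (eLpNorm g q μ).toReal := by
  have h := eLpNorm_smul_le_mul_eLpNorm (p := p) (q := q) (r := 1) hg.1 hf.1
  have h1 : ‖∫ t, f t * g t ∂μ‖ₑ ≤ eLpNorm f p μ * eLpNorm g q μ := by
    refine (enorm_integral_le_lintegral_enorm _).trans ?_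
    rwa [eLpNorm_one_eq_lintegral_enorm] at h
  have h2 := ENNReal.toReal_mono (ENNReal.mul_ne_top hf.2.ne hg.2.ne) h1
  rw [ENNReal.toReal_mul, toReal_enorm] at h2
  exact (le_abs_self _).trans h2

theorem costJ_eq_coe {m n : ℕ} {D : Compacts (Euc m)} {p : ℝ≥0∞} [Fact (1 ≤ p)]
    {σ : Measure (Bdry D)} {A : LpSpace D n p →L[ℝ] CSpace D n}
    {φ : Bdry D → Euc n → EReal} {f : D → Euc n × Euc n → EReal} {u : LpSpace D n p}
    {a : Bdry D → ℝ} {b : D → ℝ}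
    (ha : ∀ᵐ s ∂σ, φ s (A u (bdryPoint s)) = (a s : EReal))
    (hb : ∀ᵐ t ∂leb D, f t (A u t, u t) = (b t : EReal))
    (hai : Integrable a σ) (hbi : Integrable b (leb D)) :
    costJ σ A φ f u = (((∫ s, a s ∂σ) + ∫ t, b t ∂leb D : ℝ) : EReal) := by
  rw [costJ, extIntegral_eq_integral ha hai, extIntegral_eq_integral hb hbi, EReal.coe_add]

theorem measurable_bdryPoint {m : ℕ} {D : Compacts (Euc m)} :
    Measurable (bdryPoint : Bdry D → D) :=
  measurable_subtype_coe.subtype_mk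

end OperatorInclusion

/-! ### The exact penalty theorem. -/

theorem mainTheorem11 {m n : ℕ} (D : Compacts (Euc m))
    (hD : (interior (D : Set (Euc m))).Nonempty)
    (σ : Measure (Bdry D))
    (p q : ℝ≥0∞) [Fact (1 ≤ p)] (hp : p ≠ ⊤) (hpq : p⁻¹ + q⁻¹ = 1)
    (A : LpSpace D n p →L[ℝ] CSpace D n)
    (F : D → Euc n → NonemptyCompacts (Euc n))
    (hFmeas : ∀ x, MeasurableMultimap (leb D) (fun t => (F t x : Set (Euc n))))
    (f : D → Euc n × Euc n → EReal) (hf : IsNormalIntegrand (leb D) f)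
    (φ : Bdry D → Euc n → EReal) (hφ : IsNormalIntegrand σ φ)
    (M : D → ℝ) (hM : MemLp M p (leb D))
    (hMpos : ∀ᵐ t ∂leb D, 0 < M t)
    -- `dist` on `NonemptyCompacts` is the Hausdorff distance
    (hFLip : ∀ᵐ t ∂leb D, ∀ x x₁, dist (F t x) (F t x₁) ≤ M t * ‖x - x₁‖)
    (hAM : ‖A‖ * (eLpNorm M p (leb D)).toReal < 1)
    (k : D → ℝ) (hk : Integrable k (leb D))
    (hk_nonneg : ∀ᵐ t ∂leb D, 0 ≤ k t)
    (k₁ : D → ℝ) (hk₁ : MemLp k₁ q (leb D))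
    (hk₁_nonneg : ∀ᵐ t ∂leb D, 0 ≤ k₁ t)
    (k₂ : Bdry D → ℝ) (hk₂ : Integrable k₂ σ) (hk₂_nonneg : ∀ᵐ s ∂σ, 0 ≤ k₂ s)
    (hfLip : ∀ᵐ t ∂leb D, ∀ x₁ y₁ x₂ y₂,
      (f t (x₁, y₁) - f t (x₂, y₂)).abs ≤
        ENNReal.ofReal (k t * ‖x₁ - x₂‖ + k₁ t * ‖y₁ - y₂‖))
    (hφLip : ∀ᵐ s ∂σ, ∀ x y, (φ s x - φ s y).abs ≤ ENNReal.ofReal (k₂ s * ‖x - y‖))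
    (ū : LpSpace D n p)
    (hū : IsMinimizer (costJ σ A φ f) (inclusionSolutions A F) ū) :
    ∀ r : ℝ, threshold σ A q M k k₁ k₂ ≤ r →
      IsMinimizer (penalizedJ σ A φ f F r) Set.univ ū := by
  intro r hr
  obtain ⟨hūS, hūbot, hūtop, hūmin⟩ := hū
  have hconj : ENNReal.HolderConjugate p q := ENNReal.holderConjugate_iff.2 hpq
  let a : LpSpace D n p → Bdry D → ℝ := fun u s => (φ s (A u (bdryPoint s))).toReal
  let b : LpSpace D n p → D → ℝ := fun u t => (f t (A u t, u t)).toReal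
  have ha : ∀ u, ∀ᵐ s ∂σ, φ s (A u (bdryPoint s)) = (a u s : EReal) := fun u => by
    filter_upwards [hφLip] with s hs using eq_coe_toReal_of_abs_sub_le (hs _ _)
  have hb : ∀ u : LpSpace D n p, ∀ᵐ t ∂leb D, f t (A u t, u t) = (b u t : EReal) := fun u => by
    filter_upwards [hfLip] with t ht using eq_coe_toReal_of_abs_sub_le (ht _ _ _ _)
  have ham : ∀ u, AEMeasurable (a u) σ := fun u =>
    (hφ.aemeasurable_comp ((A u).continuous.measurable.comp
      measurable_bdryPoint).aemeasurable).ereal_toReal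
  have hbm : ∀ u, AEMeasurable (b u) (leb D) := fun u =>
    (hf.aemeasurable_comp ((aemeasurable_apply u A).prodMk
      (Lp.aestronglyMeasurable u).aemeasurable)).ereal_toReal
  have hadiff : ∀ u v, ∀ᵐ s ∂σ, |a u s - a v s| ≤ k₂ s * (‖A‖ * ‖u - v‖) := fun u v => by
    filter_upwards [hφLip, ha u, ha v, hk₂_nonneg] with s h1 h2 h3 h4
    refine (abs_toReal_sub_le h2 h3 (by positivity) (h1 _ _)).trans ?_
    exact mul_le_mul_of_nonneg_left (norm_apply_sub_le A u v _) h4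
  have hbdiff : ∀ u v : LpSpace D n p, ∀ᵐ t ∂leb D,
      |b u t - b v t| ≤ k t * (‖A‖ * ‖u - v‖) + k₁ t * ‖u t - v t‖ := fun u v => by
    filter_upwards [hfLip, hb u, hb v, hk_nonneg, hk₁_nonneg] with t h1 h2 h3 h4 h5
    refine (abs_toReal_sub_le h2 h3 (by positivity) (h1 _ _ _ _)).trans ?_
    exact add_le_add (mul_le_mul_of_nonneg_left (norm_apply_sub_le A u v _) h4) le_rfl
  have hk₁int : ∀ {g : D → ℝ}, MemLp g p (leb D) → Integrable (fun t => k₁ t * g t) (leb D) := by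
    intro g hg
    have : Integrable (g * k₁) (leb D) := hg.integrable_mul hk₁
    refine this.congr (Filter.Eventually.of_forall fun t => mul_comm _ _)
  have hk₁sub : ∀ u v : LpSpace D n p,
      Integrable (fun t => k₁ t * ‖u t - v t‖) (leb D) := fun u v =>
    hk₁int ((Lp.memLp u).sub (Lp.memLp v)).norm
  -- finiteness of both integrals at `ū`
  have hcost : extIntegral σ (fun s => φ s (A ū (bdryPoint s))) +
    extIntegral (leb D) (fun t => f t (A ū t, ū t)) = costJ σ A φ f ū := rfl
  rw [← hcost] at hūbot hūtop
  obtain ⟨hb1, hb2⟩ := EReal.add_ne_bot_iff.1 hūbot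
  have ht1 : extIntegral σ (fun s => φ s (A ū (bdryPoint s))) ≠ ⊤ := fun h =>
    hūtop (by rw [h, EReal.top_add_of_ne_bot hb2])
  have ht2 : extIntegral (leb D) (fun t => f t (A ū t, ū t)) ≠ ⊤ := fun h =>
    hūtop (by rw [h, EReal.add_top_of_ne_bot hb1])
  have hai : ∀ u, Integrable (a u) σ := fun u => by
    have h1 := integrable_of_extIntegral (ha ū) (ham ū) ht1 hb1
    have h2 : Integrable (fun s => a u s - a ū s) σ :=
      (hk₂.mul_const _).mono' ((ham u).sub (ham ū)).aestronglyMeasurable (hadiff u ū)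
    exact (h2.add h1).congr (Filter.Eventually.of_forall fun s => sub_add_cancel _ _)
  have hbi : ∀ u, Integrable (b u) (leb D) := fun u => by
    have h1 := integrable_of_extIntegral (hb ū) (hbm ū) ht2 hb2
    have h2 : Integrable (fun t => b u t - b ū t) (leb D) :=
      ((hk.mul_const _).add (hk₁sub u ū)).mono' ((hbm u).sub (hbm ū)).aestronglyMeasurable
        (hbdiff u ū)
    exact (h2.add h1).congr (Filter.Eventually.of_forall fun s => sub_add_cancel _ _)
  have hJ : ∀ u, costJ σ A φ f u = (((∫ s, a u s ∂σ) + ∫ t, b u t ∂leb D : ℝ) : EReal) :=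
    fun u => costJ_eq_coe (ha u) (hb u) (hai u) (hbi u)
  have hψ := memLp_psi hFmeas hM hFLip hūS
  set N := (eLpNorm M p (leb D)).toReal with hN
  have key : ∀ u : LpSpace D n p, (∫ s, a ū s ∂σ) + ∫ t, b ū t ∂leb D ≤
      (∫ s, a u s ∂σ) + (∫ t, b u t ∂leb D) +
        threshold σ A q M k k₁ k₂ * (penalty A F u).toReal := by
    intro u
    set E := (penalty A F u).toReal with hE
    let B : ℝ → ℝ := fun δ => (E + 4 * δ * N) / (1 - ‖A‖ * N)
    -- The upper bound for `J w` in terms of `u` and `δ`. It is affine in `δ`, and at `δ = 0` it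
    -- equals `J u` plus `threshold` times `E`.
    let G : ℝ → ℝ := fun δ => (∫ s, a u s ∂σ) + (∫ t, b u t ∂leb D) +
      ((∫ s, k₂ s ∂σ) * (‖A‖ * B δ) + ((∫ t, k t ∂leb D) * (‖A‖ * B δ) +
        (E * (eLpNorm k₁ q (leb D)).toReal +
          (4 * δ + ‖A‖ * B δ) * ∫ t, k₁ t * M t ∂leb D)))
    have hG : ∀ δ, 0 < δ → (∫ s, a ū s ∂σ) + ∫ t, b ū t ∂leb D ≤ G δ := by
      intro δ hδ
      obtain ⟨w, hwS, hwB, hwpt⟩ := exists_inclusionSolution_near hFmeas hM hMpos hFLip hAM hψ u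
        hδ (B := B δ) rfl
      have h1 := hūmin w hwS
      rw [hJ, hJ, EReal.coe_le_coe_iff] at h1
      have h2 : ∫ s, a w s ∂σ ≤ (∫ s, a u s ∂σ) + (∫ s, k₂ s ∂σ) * (‖A‖ * B δ) := by
        rw [← integral_mul_const, ← integral_add (hai u) (hk₂.mul_const _)]
        refine integral_mono_ae (hai w) ((hai u).add (hk₂.mul_const _)) ?_
        filter_upwards [hadiff w u, hk₂_nonneg] with s hs hs0
        have h3 : k₂ s * (‖A‖ * ‖w - u‖) ≤ k₂ s * (‖A‖ * B δ) := by gcongr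
        have := (abs_le.1 hs).2
        linarith
      have h3 : ∫ t, k₁ t * psi F t (A u t) (u t) ∂leb D ≤
          E * (eLpNorm k₁ q (leb D)).toReal := by
        have := integral_mul_le_toReal_eLpNorm_mul (hψ u) hk₁
        simpa only [mul_comm (k₁ _)] using! this
      have h4 : ∫ t, b w t ∂leb D ≤ (∫ t, b u t ∂leb D) + ((∫ t, k t ∂leb D) * (‖A‖ * B δ) +
          ((∫ t, k₁ t * psi F t (A u t) (u t) ∂leb D) +
            (∫ t, k₁ t * M t ∂leb D) * (4 * δ + ‖A‖ * B δ))) := by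
        have i1 := hk.mul_const (‖A‖ * B δ)
        have i2 := hk₁int (hψ u)
        have i3 := (hk₁int hM).mul_const (4 * δ + ‖A‖ * B δ)
        have i4 : Integrable (fun t => k₁ t * psi F t (A u t) (u t) +
            k₁ t * M t * (4 * δ + ‖A‖ * B δ)) (leb D) := i2.add i3
        have i5 : Integrable (fun t => k t * (‖A‖ * B δ) + (k₁ t * psi F t (A u t) (u t) +
            k₁ t * M t * (4 * δ + ‖A‖ * B δ))) (leb D) := i1.add i4
        rw [← integral_mul_const, ← integral_mul_const, ← integral_add i2 i3,
          ← integral_add i1 i4, ← integral_add (hbi u) i5]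
        refine integral_mono_ae (hbi w) ((hbi u).add i5) ?_
        filter_upwards [hbdiff w u, hwpt, hk_nonneg, hk₁_nonneg] with t e1 e2 e3 e4
        have e5 : k t * (‖A‖ * ‖w - u‖) ≤ k t * (‖A‖ * B δ) := by gcongr
        have e6 := mul_le_mul_of_nonneg_left e2 e4
        have e7 := (abs_le.1 e1).2
        linarith
      simp only [G]
      linarith
    have hlim : Filter.Tendsto G (nhdsWithin 0 (Set.Ioi 0)) (nhds (G 0)) := by
      have : Continuous G := by fun_prop
      exact this.continuousWithinAt
    have h0 := ge_of_tendsto hlim (by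
      filter_upwards [self_mem_nhdsWithin] with δ hδ using hG δ hδ)
    refine h0.trans (le_of_eq ?_)
    simp only [G, B, threshold, ← hN]
    ring
  have hpen : ∀ u : LpSpace D n p, penalizedJ σ A φ f F r u =
      (((∫ s, a u s ∂σ) + (∫ t, b u t ∂leb D) + r * (penalty A F u).toReal : ℝ) : EReal) := by
    intro u
    rw [penalizedJ, hJ, EReal.coe_add _ (r * _), EReal.coe_mul,
      EReal.coe_ennreal_toReal (show penalty A F u ≠ ⊤ from (hψ u).2.ne)]
  have hpen0 : penalty A F ū = 0 := by
    rw [penalty]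
    refine eLpNorm_eq_zero_of_ae_zero ?_
    filter_upwards [hūS] with t ht using psi_eq_zero_of_mem ht
  refine ⟨Set.mem_univ _, ?_, ?_, fun u _ => ?_⟩
  · rw [hpen]; exact EReal.coe_ne_bot _
  · rw [hpen]; exact EReal.coe_ne_top _
  · rw [hpen, hpen, hpen0, EReal.coe_le_coe_iff, ENNReal.toReal_zero, mul_zero, add_zero]
    have := mul_le_mul_of_nonneg_right hr (ENNReal.toReal_nonneg (a := penalty A F u))
    linarith [key u]
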